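/- A rearrangement-invariant (r.i.) space $X$ on $(0,\infty)$ is the space of measurable functions $f$ with $\|f\|_X=\rho(|f|)<\infty$, where $\rho$ is a functional with values in $[0,\infty]$, defined on the measurable functions $(0,\infty)\to[0,\infty]$ (with Lebesgue measure, functions equal a.e. being identified), such that for all such $f,g$: (a) $\rho(f)=0$ iff $f=0$ a.e., $\rho(af)=a\rho(f)$ for real $a\ge 0$, $\rho(f+g)\le\rho(f)+\rho(g)$; (b) $f\le g$ a.e. implies $\rho(f)\le\rho(g)$; (c) $f_n\uparrow f$ a.e. implies $\rho(f_n)\uparrow\rho(f)$; (d) if $|E|<\infty$ then $\rho(\chi_E)<\infty$ and there is $C_E<\infty$ with $\int_E f\le C_E\,\rho(f)$ for all $f$; (e) $\rho(f)=\rho(g)$ whenever $f^*=g^*$. Here, for measurable $f$ and $t>0$, $$f^*(t)=\inf\{s\ge 0: |\{|f|>s\}|\le t\},\qquad f^{**}(t)=\frac1t\int_0^t f^*(s)\,ds .$$ For $s>0$ let $h_X(s)$ be the norm on $X$ of the dilation operator $E_sf(t)=f^*(t/s)$, and define the lower and upper Boyd indices of $X$ by $$\underline{\alpha}_X=\sup_{0<s<1}\frac{\ln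 h_X(s)}{\ln s},\qquad \overline{\alpha}_X=\inf_{s>1}\frac{\ln h_X(s)}{\ln s}.$$ All norms below are allowed to take the value $\infty$. **Theorem 2.3.** Let $X$ be an r.i. space on $(0,\infty)$ that contains no nonzero constant function, and let $D>0$ be a real number. (i) If $\underline{\alpha}_X>1/D$, then there is a constant $C\in(0,\infty)$, depending only on $X$ and $D$, such that for every real-valued measurable function $f$ on $(0,\infty)$ that belongs to $X$ or satisfies $\lim_{t\to\infty}f^{**}(t)=0$, $$C^{-1}\,\big\|t^{-1/D}[f^{**}(t)-f^*(t)]\big\|_X\le\big\|t^{-1/D}f^{**}(t)\big\|_X\le C\,\big\|t^{-1/D}[f^{**}(t)-f^*(t)]\big\|_X .$$ (ii) If $\overline{\alpha}_X<1/D$, then there is a constant $C\in(0,\infty)$, depending only on $X$ and $D$, such that for every real-valued measurable function $f$ on $(0,\infty)$ with $f\in L^1+L^\infty$, $$\|f\|_{L^\infty}\le C\Big(\big\|t^{-1/D}[f^{**}(t)-f^*(t)]\big\|_X+\|f\|_{L^1+L^\infty}\Big),$$ where $\|f\|_{L^1+L^\infty}=\inf\{\|g\|_{L^1}+\|h\|_{L^\infty}: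 f=g+h\}$. (For $f\notin L^1+L^\infty$ the right-hand side is understood as $\infty$ and the inequality is trivial.) -/

import Mathlib

open MeasureTheory Set Filter Topology
open scoped ENNReal NNReal

noncomputable section

/-- Lebesgue measure on `(0, ∞)`, as a measure on `ℝ` carried by `Ioi 0`. -/
def lebPos : Measure ℝ := volume.restrict (Ioi 0)

/-- Decreasing rearrangement `f^*(t) = inf {s ≥ 0 : |{f > s}| ≤ t}` of a nonnegative function
on `(0, ∞)`; the infimum of the empty set of finite levels is `∞`. -/
def rearr (f : ℝ → ℝ≥0∞) (t : ℝ) : ℝ≥0∞ :=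
  sInf {s : ℝ≥0∞ | lebPos {x | s < f x} ≤ ENNReal.ofReal t}

/-- The maximal function `f^{**}(t) = (1/t) ∫_0^t f^*(s) ds` (used for `t > 0`). -/
def rearrAvg (f : ℝ → ℝ≥0∞) (t : ℝ) : ℝ≥0∞ :=
  (ENNReal.ofReal t)⁻¹ * ∫⁻ s in Ioc 0 t, rearr f s

/-- The oscillation `f^{**}(t) - f^*(t)`. -/
def rearrOsc (f : ℝ → ℝ≥0∞) (t : ℝ) : ℝ≥0∞ :=
  rearrAvg f t - rearr f t

/-- A rearrangement-invariant Banach function space on `(0, ∞)` with Lebesgue measure, given by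
its function norm on nonnegative measurable functions (only the values of `fnorm` on
a.e.-measurable functions matter). -/
structure RISpace where
  fnorm : (ℝ → ℝ≥0∞) → ℝ≥0∞
  fnorm_eq_zero_iff : ∀ f, AEMeasurable f lebPos → (fnorm f = 0 ↔ f =ᵐ[lebPos] 0)
  fnorm_const_mul : ∀ (a : ℝ≥0) (f : ℝ → ℝ≥0∞), AEMeasurable f lebPos →
    fnorm (fun x => (a : ℝ≥0∞) * f x) = a * fnorm f
  fnorm_add_le : ∀ f g, AEMeasurable f lebPos → AEMeasurable g lebPos →
    fnorm (fun x => f x + g x) ≤ fnorm f + fnorm g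
  fnorm_mono : ∀ f g, AEMeasurable f lebPos → AEMeasurable g lebPos →
    (∀ᵐ x ∂lebPos, f x ≤ g x) → fnorm f ≤ fnorm g
  /-- the Fatou property -/
  fnorm_iSup : ∀ f : ℕ → ℝ → ℝ≥0∞, (∀ n, AEMeasurable (f n) lebPos) →
    (∀ᵐ x ∂lebPos, Monotone fun n => f n x) →
    fnorm (fun x => ⨆ n, f n x) = ⨆ n, fnorm (f n)
  fnorm_indicator_lt_top : ∀ E : Set ℝ, MeasurableSet E → lebPos E < ∞ →
    fnorm (E.indicator fun _ => 1) < ∞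
  setLIntegral_le : ∀ E : Set ℝ, MeasurableSet E → lebPos E < ∞ →
    ∃ C : ℝ≥0, ∀ f, AEMeasurable f lebPos → ∫⁻ x in E, f x ∂lebPos ≤ C * fnorm f
  /-- rearrangement invariance -/
  fnorm_eq_of_rearr_eq : ∀ f g, AEMeasurable f lebPos → AEMeasurable g lebPos →
    rearr f = rearr g → fnorm f = fnorm g

namespace RISpace

/-- Membership of a real-valued function in the space. -/
def Mem (X : RISpace) (f : ℝ → ℝ) : Prop :=
  AEMeasurable f lebPos ∧ X.fnorm (fun x => ‖f x‖ₑ) < ∞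

/-- `h_X(s)`: the norm on `X` of the dilation operator `E_s f(t) = f^*(t/s)`. -/
def dilationNorm (X : RISpace) (s : ℝ) : ℝ≥0∞ :=
  ⨆ (f : ℝ → ℝ≥0∞) (_ : AEMeasurable f lebPos) (_ : X.fnorm f ≤ 1),
    X.fnorm (fun t => rearr f (t / s))

/-- Upper Boyd index `inf_{s > 1} ln h_X(s) / ln s`. -/
def upperBoyd (X : RISpace) : EReal :=
  ⨅ s ∈ Ioi (1 : ℝ), ENNReal.log (X.dilationNorm s) / ((Real.log s : ℝ) : EReal)

/-- Lower Boyd index `sup_{0 < s < 1} ln h_X(s) / ln s`. -/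
def lowerBoyd (X : RISpace) : EReal :=
  ⨆ s ∈ Ioo (0 : ℝ) 1, ENNReal.log (X.dilationNorm s) / ((Real.log s : ℝ) : EReal)

end RISpace

/-- The norm of `L¹ + L^∞` on `(0, ∞)`, with value `∞` outside this space. -/
def sumNorm (f : ℝ → ℝ) : ℝ≥0∞ :=
  ⨅ (g : ℝ → ℝ) (h : ℝ → ℝ) (_ : AEStronglyMeasurable g lebPos)
    (_ : AEStronglyMeasurable h lebPos) (_ : f =ᵐ[lebPos] g + h),
    eLpNorm g 1 lebPos + eLpNorm h ∞ lebPos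

end

/-! Write osc = f** - f*. Since t·osc(t) is the integral of f*(s) - f*(t) over (0,t], it is
nondecreasing, and f**(t) ≤ f**(rt) + r·osc(rt) for r > 1. Iterating (`rearrAvg_le_add_sum`) bounds
f**(t) by f**(r^N t) plus r times the sum of osc(r^n t), 1 ≤ n ≤ N. In (i), f** vanishes at
infinity, so N → ∞ leaves only oscillations. Their weighted dilates have norms decaying
geometrically, because h_X(1/r) < r^(-1/D) for some r. In (ii), start at t = r^(-N) and stop at 1.
Each osc(r^(-n)) is tested against the indicator of (1,r], and h_X(r) < r^(1/D) makes these bounds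
geometric; f**(1) is controlled by the L¹ + L^∞ norm. Letting N → ∞ bounds f*(0+), the essential
supremum. -/

/-! ### Rearrangements, distribution functions and dilations. -/

theorem lebPos_ofReal_lt (m : ℝ≥0∞) : lebPos {x | ENNReal.ofReal x < m} = m := by
  unfold lebPos
  rw [Measure.restrict_apply (measurableSet_lt ENNReal.measurable_ofReal measurable_const)]
  rcases eq_or_ne m ∞ with rfl | hm
  · simp
  · have : {x | ENNReal.ofReal x < m} ∩ Ioi 0 = Ioo 0 m.toReal := by
      ext x
      simp only [mem_inter_iff, mem_ofPred_eq, mem_Ioi, mem_Ioo]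
      constructor
      · rintro ⟨h1, h2⟩
        exact ⟨h2, (ENNReal.ofReal_lt_iff_lt_toReal h2.le hm).1 h1⟩
      · rintro ⟨h1, h2⟩
        exact ⟨(ENNReal.ofReal_lt_iff_lt_toReal h1.le hm).2 h2, h1⟩
    rw [this, Real.volume_Ioo, sub_zero, ENNReal.ofReal_toReal hm]

theorem rearr_antitone (f : ℝ → ℝ≥0∞) : Antitone (rearr f) := fun _ _ h =>
  sInf_le_sInf fun _ hs => le_trans hs (ENNReal.ofReal_le_ofReal h)

theorem measurable_rearr (f : ℝ → ℝ≥0∞) : Measurable (rearr f) :=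
  (rearr_antitone f).measurable

/-- The distribution function is right-continuous in the level, so the infimum is attained. -/
theorem rearr_le_iff (f : ℝ → ℝ≥0∞) (t : ℝ) (s : ℝ≥0∞) :
    rearr f t ≤ s ↔ lebPos {x | s < f x} ≤ ENNReal.ofReal t := by
  refine ⟨fun h => ?_, fun h => sInf_le h⟩
  rcases eq_or_ne s ∞ with rfl | hs
  · simp
  obtain ⟨u, hu, hus, hut⟩ := exists_seq_strictAnti_tendsto' (lt_top_iff_ne_top.2 hs)
  have hU : {x | s < f x} = ⋃ n, {x | u n < f x} := by
    ext x
    simp only [mem_ofPred_eq, mem_iUnion]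
    exact ⟨fun hx => (hut.eventually_lt_const hx).exists,
      fun ⟨n, hn⟩ => (hus n).1.trans hn⟩
  have hmono : Monotone fun n => {x | u n < f x} := fun m n hmn x hx =>
    (hu.antitone hmn).trans_lt hx
  rw [hU, hmono.measure_iUnion]
  refine iSup_le fun n => ?_
  obtain ⟨v, hv, hvu⟩ := sInf_lt_iff.1 (h.trans_lt (hus n).1)
  exact (measure_mono fun x hx => hvu.trans hx).trans hv

theorem lt_rearr_iff (f : ℝ → ℝ≥0∞) (t : ℝ) (s : ℝ≥0∞) :
    s < rearr f t ↔ ENNReal.ofReal t < lebPos {x | s < f x} := by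
  rw [← not_le, rearr_le_iff, not_le]

theorem rearr_congr_distrib {f g : ℝ → ℝ≥0∞}
    (h : ∀ s, lebPos {x | s < f x} = lebPos {x | s < g x}) : rearr f = rearr g := by
  funext t
  simp only [rearr, h]

theorem lebPos_lt_rearr (f : ℝ → ℝ≥0∞) (s : ℝ≥0∞) :
    lebPos {x | s < rearr f x} = lebPos {x | s < f x} := by
  simp only [lt_rearr_iff, lebPos_ofReal_lt]

theorem rearr_rearr (f : ℝ → ℝ≥0∞) : rearr (rearr f) = rearr f :=
  rearr_congr_distrib (lebPos_lt_rearr f)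

/-- Layer cake: Tonelli on the region under the graph. -/
theorem lintegral_lebPos_eq_distrib {f : ℝ → ℝ≥0∞} (hf : AEMeasurable f lebPos) :
    ∫⁻ x, f x ∂lebPos = ∫⁻ s, lebPos {x | ENNReal.ofReal s < f x} ∂lebPos := by
  have : SFinite lebPos := by unfold lebPos; infer_instance
  have key : ∀ g : ℝ → ℝ≥0∞, Measurable g →
      ∫⁻ x, g x ∂lebPos = ∫⁻ s, lebPos {x | ENNReal.ofReal s < g x} ∂lebPos := by
    intro g hg
    have hm : MeasurableSet {p : ℝ × ℝ | ENNReal.ofReal p.2 < g p.1} :=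
      measurableSet_lt (ENNReal.measurable_ofReal.comp measurable_snd) (hg.comp measurable_fst)
    refine Eq.trans ?_ ((Measure.prod_apply hm).symm.trans (Measure.prod_apply_symm hm))
    exact lintegral_congr fun x => (lebPos_ofReal_lt (g x)).symm
  rw [lintegral_congr_ae hf.ae_eq_mk, key _ hf.measurable_mk]
  refine lintegral_congr fun s => measure_congr ?_
  filter_upwards [hf.ae_eq_mk] with x hx
  exact congrArg (fun y => ENNReal.ofReal s < y) hx.symm

theorem lintegral_rearr {f : ℝ → ℝ≥0∞} (hf : AEMeasurable f lebPos) :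
    ∫⁻ x, rearr f x ∂lebPos = ∫⁻ x, f x ∂lebPos := by
  rw [lintegral_lebPos_eq_distrib hf,
    lintegral_lebPos_eq_distrib (measurable_rearr f).aemeasurable]
  simp only [lebPos_lt_rearr]

theorem lebPos_restrict_Ioc (t : ℝ) : lebPos.restrict (Ioc 0 t) = volume.restrict (Ioc 0 t) := by
  unfold lebPos
  rw [Measure.restrict_restrict measurableSet_Ioc,
    inter_eq_left.2 fun x hx => hx.1]

theorem map_mul_left_lebPos {r : ℝ} (hr : 0 < r) :
    lebPos.map (r * ·) = ENNReal.ofReal r⁻¹ • lebPos := by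
  have hpre : (r * · : ℝ → ℝ) ⁻¹' Ioi 0 = Ioi 0 := by
    ext x; simp [hr]
  have h := Measure.restrict_map (μ := volume) (measurable_const_mul r)
    (measurableSet_Ioi (a := (0 : ℝ)))
  rw [hpre, Real.map_volume_mul_left hr.ne', abs_of_pos (inv_pos.2 hr),
    Measure.restrict_smul] at h
  exact h.symm

theorem lebPos_preimage_mul_left {r : ℝ} (hr : 0 < r) (A : Set ℝ) :
    lebPos {x | r * x ∈ A} = ENNReal.ofReal r⁻¹ * lebPos A := by
  have h := congrArg (fun μ : Measure ℝ => μ A) (map_mul_left_lebPos hr)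
  exact ((Homeomorph.mulLeft₀ r hr.ne').measurableEmbedding.map_apply lebPos A).symm.trans h

theorem aemeasurable_comp_mul_left {r : ℝ} (hr : 0 < r) {f : ℝ → ℝ≥0∞}
    (hf : AEMeasurable f lebPos) : AEMeasurable (fun x => f (r * x)) lebPos := by
  refine AEMeasurable.comp_aemeasurable (f := (r * ·)) ?_ (measurable_const_mul r).aemeasurable
  rw [map_mul_left_lebPos hr]
  exact hf.smul_measure _

theorem lebPos_lt_comp_mul_left {r : ℝ} (hr : 0 < r) (f : ℝ → ℝ≥0∞) (s : ℝ≥0∞) :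
    lebPos {x | s < f (r * x)} = ENNReal.ofReal r⁻¹ * lebPos {x | s < f x} :=
  lebPos_preimage_mul_left hr {x | s < f x}

theorem rearr_comp_mul_left {r : ℝ} (hr : 0 < r) (f : ℝ → ℝ≥0∞) :
    rearr (fun t => f (r * t)) = rearr fun t => rearr f (r * t) :=
  rearr_congr_distrib fun s => by
    rw [lebPos_lt_comp_mul_left hr, lebPos_lt_comp_mul_left hr, lebPos_lt_rearr]

theorem ae_lebPos_pos : ∀ᵐ t ∂lebPos, 0 < t := ae_restrict_mem measurableSet_Ioi

theorem rearr_congr_ae {f g : ℝ → ℝ≥0∞} (h : f =ᵐ[lebPos] g) : rearr f = rearr g :=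
  rearr_congr_distrib fun s => measure_congr <| by
    filter_upwards [h] with x hx
    exact congrArg (fun y => s < y) hx

/-! ### Dilations and Boyd indices in X. -/

namespace RISpace

variable (X : RISpace)

theorem fnorm_rearr {f : ℝ → ℝ≥0∞} (hf : AEMeasurable f lebPos) :
    X.fnorm (rearr f) = X.fnorm f :=
  X.fnorm_eq_of_rearr_eq _ _ (measurable_rearr f).aemeasurable hf (rearr_rearr f)

theorem fnorm_comp_mul_left {r : ℝ} (hr : 0 < r) {f : ℝ → ℝ≥0∞} (hf : AEMeasurable f lebPos) :
    X.fnorm (fun t => f (r * t)) = X.fnorm fun t => rearr f (t / r⁻¹) := by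
  simp only [div_inv_eq_mul, mul_comm _ r]
  exact X.fnorm_eq_of_rearr_eq _ _ (aemeasurable_comp_mul_left hr hf)
    (aemeasurable_comp_mul_left hr (measurable_rearr f).aemeasurable) (rearr_comp_mul_left hr f)

/-- Dilation is bounded on `X` by `h_X`, up to passing to a strictly larger constant. -/
theorem fnorm_comp_mul_left_le {r : ℝ} (hr : 0 < r) {κ : ℝ≥0∞} (hκ : X.dilationNorm r⁻¹ < κ)
    {f : ℝ → ℝ≥0∞} (hf : AEMeasurable f lebPos) :
    X.fnorm (fun t => f (r * t)) ≤ κ * X.fnorm f := by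
  rcases eq_or_ne (X.fnorm f) ∞ with h | h
  · rw [h, ENNReal.mul_top (pos_of_gt hκ).ne']
    exact le_top
  rcases eq_or_ne (X.fnorm f) 0 with h0 | h0
  -- Normalising is impossible here, but f and its dilate both vanish a.e.
  · have h1 : rearr f = rearr 0 := rearr_congr_ae ((X.fnorm_eq_zero_iff f hf).1 h0)
    have h2 : rearr (fun t => f (r * t)) = rearr f := by
      refine rearr_congr_distrib fun s => ?_
      rw [lebPos_lt_comp_mul_left hr, ← lebPos_lt_rearr f, h1, lebPos_lt_rearr]
      simp
    rw [X.fnorm_eq_of_rearr_eq _ _ (aemeasurable_comp_mul_left hr hf) hf h2, h0]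
    exact zero_le
  obtain ⟨a, ha⟩ : ∃ a : ℝ≥0, (a : ℝ≥0∞) = (X.fnorm f)⁻¹ :=
    ⟨((X.fnorm f)⁻¹).toNNReal, ENNReal.coe_toNNReal (ENNReal.inv_ne_top.2 h0)⟩
  have haf : AEMeasurable (fun x => (a : ℝ≥0∞) * f x) lebPos := hf.const_mul _
  have h1 : X.fnorm (fun x => (a : ℝ≥0∞) * f x) ≤ 1 := by
    rw [X.fnorm_const_mul a f hf, ha, ENNReal.inv_mul_cancel h0 h]
  have h2 : X.fnorm (fun t => (a : ℝ≥0∞) * f (r * t)) ≤ κ := by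
    have := X.fnorm_comp_mul_left hr haf
    rw [this]
    refine le_trans ?_ hκ.le
    exact le_iSup_of_le _ (le_iSup_of_le haf (le_iSup_of_le h1 le_rfl))
  rw [X.fnorm_const_mul a _ (aemeasurable_comp_mul_left hr hf), ha] at h2
  rwa [← ENNReal.div_eq_inv_mul, ENNReal.div_le_iff h0 h] at h2

theorem fnorm_comp_pow_mul_left_le {r : ℝ} (hr : 0 < r) {κ : ℝ≥0∞}
    (hκ : X.dilationNorm r⁻¹ < κ) {f : ℝ → ℝ≥0∞} (hf : AEMeasurable f lebPos) (n : ℕ) :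
    X.fnorm (fun t => f (r ^ n * t)) ≤ κ ^ n * X.fnorm f := by
  induction n with
  | zero => simp
  | succ n ih =>
    have h := X.fnorm_comp_mul_left_le hr hκ (aemeasurable_comp_mul_left (pow_pos hr n) hf)
    simp only [← mul_assoc, ← pow_succ] at h
    calc _ ≤ _ := h
      _ ≤ κ * (κ ^ n * X.fnorm f) := by gcongr
      _ = _ := by ring

/-- The Fatou property applied to partial sums. -/
theorem fnorm_tsum_le {f : ℕ → ℝ → ℝ≥0∞} (hf : ∀ n, AEMeasurable (f n) lebPos) :
    X.fnorm (fun t => ∑' n, f n t) ≤ ∑' n, X.fnorm (f n) := by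
  have hm : ∀ N, AEMeasurable (fun t => ∑ n ∈ Finset.range N, f n t) lebPos := fun N =>
    Finset.aemeasurable_fun_sum _ fun n _ => hf n
  have hfin : ∀ N, X.fnorm (fun t => ∑ n ∈ Finset.range N, f n t)
      ≤ ∑ n ∈ Finset.range N, X.fnorm (f n) := by
    intro N
    induction N with
    | zero => simpa using ((X.fnorm_eq_zero_iff (fun _ => 0) aemeasurable_const).2 (by rfl)).le
    | succ N ih =>
      simp only [Finset.sum_range_succ]
      exact (X.fnorm_add_le _ _ (hm N) (hf N)).trans (by gcongr)
  simp only [ENNReal.tsum_eq_iSup_nat]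
  rw [X.fnorm_iSup _ hm]
  · exact iSup_mono hfin
  · exact ae_of_all _ fun t m n hmn =>
      Finset.sum_le_sum_of_subset (Finset.range_mono hmn)

/-- A lower Boyd index above `a` is witnessed by one contracting dilation. -/
theorem exists_dilationNorm_lt_of_lt_lowerBoyd {a : ℝ} (h : (a : EReal) < X.lowerBoyd) :
    ∃ s ∈ Ioo (0 : ℝ) 1, X.dilationNorm s < ENNReal.ofReal (s ^ a) := by
  obtain ⟨s, h⟩ := lt_iSup_iff.1 h
  obtain ⟨hs, h⟩ := lt_iSup_iff.1 h
  refine ⟨s, hs, lt_of_not_ge fun hle => h.not_ge ?_⟩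
  have hl : Real.log s < 0 := Real.log_neg hs.1 hs.2
  have h1 : ((a * Real.log s : ℝ) : EReal) ≤ ENNReal.log (X.dilationNorm s) := by
    rw [← Real.log_rpow hs.1, ← ENNReal.log_ofReal_of_pos (Real.rpow_pos_of_pos hs.1 a)]
    exact ENNReal.log_monotone hle
  -- Here ln s < 0, so division reverses the inequality.
  refine (EReal.antitone_div_right_of_nonpos (EReal.coe_nonpos.2 hl.le) h1).trans ?_
  simp only
  rw [← EReal.coe_div, mul_div_cancel_right₀ _ hl.ne]

/-- An upper Boyd index below `a` is witnessed by one dilation. -/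
theorem exists_dilationNorm_lt_of_upperBoyd_lt {a : ℝ} (h : X.upperBoyd < (a : EReal)) :
    ∃ s, 1 < s ∧ X.dilationNorm s < ENNReal.ofReal (s ^ a) := by
  obtain ⟨s, h⟩ := iInf_lt_iff.1 h
  obtain ⟨hs, h⟩ := iInf_lt_iff.1 h
  have hs0 : 0 < s := zero_lt_one.trans hs
  refine ⟨s, hs, lt_of_not_ge fun hle => h.not_ge ?_⟩
  have hl : 0 < Real.log s := Real.log_pos hs
  have h1 : ((a * Real.log s : ℝ) : EReal) ≤ ENNReal.log (X.dilationNorm s) := by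
    rw [← Real.log_rpow hs0, ← ENNReal.log_ofReal_of_pos (Real.rpow_pos_of_pos hs0 a)]
    exact ENNReal.log_monotone hle
  refine le_trans ?_ (EReal.monotone_div_right_of_nonneg (EReal.coe_nonneg.2 hl.le) h1)
  simp only
  rw [← EReal.coe_div, mul_div_cancel_right₀ _ hl.ne']

end RISpace

/-! ### Averages and oscillations. -/

theorem ofReal_mul_rearrAvg (f : ℝ → ℝ≥0∞) {t : ℝ} (ht : 0 < t) :
    ENNReal.ofReal t * rearrAvg f t = ∫⁻ s in Ioc 0 t, rearr f s := by
  rw [rearrAvg, ← mul_assoc, ENNReal.mul_inv_cancel (by simpa using ht) ENNReal.ofReal_ne_top,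
    one_mul]

theorem rearr_le_rearrAvg (f : ℝ → ℝ≥0∞) {t : ℝ} (ht : 0 < t) : rearr f t ≤ rearrAvg f t := by
  have ht0 : ENNReal.ofReal t ≠ 0 := by simpa using ht
  rw [← ENNReal.mul_le_mul_iff_right ht0 ENNReal.ofReal_ne_top, ofReal_mul_rearrAvg f ht]
  calc ENNReal.ofReal t * rearr f t = ∫⁻ _ in Ioc 0 t, rearr f t := by simp [mul_comm]
    _ ≤ _ := setLIntegral_mono (measurable_rearr f) fun s hs => rearr_antitone f hs.2

/-- Written this way, the oscillation times `t` is visibly nondecreasing. -/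
theorem ofReal_mul_rearrOsc (f : ℝ → ℝ≥0∞) {t : ℝ} (ht : 0 < t) :
    ENNReal.ofReal t * rearrOsc f t = ∫⁻ s in Ioc 0 t, (rearr f s - rearr f t) := by
  rcases eq_or_ne (rearr f t) ∞ with h | h
  -- Truncated subtraction of ∞ makes both sides 0.
  · simp [rearrOsc, h]
  · rw [rearrOsc, ENNReal.mul_sub fun _ _ => ENNReal.ofReal_ne_top, ofReal_mul_rearrAvg f ht,
      lintegral_sub measurable_const (by simp [ENNReal.mul_eq_top, h])]
    · simp [mul_comm]
    · exact (ae_restrict_iff' measurableSet_Ioc).2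
        (ae_of_all _ fun s hs => rearr_antitone f hs.2)

theorem ofReal_mul_rearrOsc_mono (f : ℝ → ℝ≥0∞) {t u : ℝ} (ht : 0 < t) (htu : t ≤ u) :
    ENNReal.ofReal t * rearrOsc f t ≤ ENNReal.ofReal u * rearrOsc f u := by
  rw [ofReal_mul_rearrOsc f ht, ofReal_mul_rearrOsc f (ht.trans_le htu)]
  calc _ ≤ ∫⁻ s in Ioc 0 t, (rearr f s - rearr f u) :=
        lintegral_mono fun s => tsub_le_tsub_left (rearr_antitone f htu) _
    _ ≤ _ := lintegral_mono_set (Ioc_subset_Ioc_right htu)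

/-- On (0,t] split f* into f*(rt) and the excess; enlarging the excess integral to (0,rt] gives
rt·osc(rt). -/
theorem rearrAvg_le_add_rearrOsc (f : ℝ → ℝ≥0∞) {r t : ℝ} (hr : 1 ≤ r) (ht : 0 < t) :
    rearrAvg f t ≤ rearrAvg f (r * t) + ENNReal.ofReal r * rearrOsc f (r * t) := by
  have hrt : t ≤ r * t := le_mul_of_one_le_left ht.le hr
  have hrt0 : 0 < r * t := ht.trans_le hrt
  have ht0 : ENNReal.ofReal t ≠ 0 := by simpa using ht
  rw [← ENNReal.mul_le_mul_iff_right ht0 ENNReal.ofReal_ne_top, ofReal_mul_rearrAvg f ht, mul_add,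
    ← mul_assoc, ← ENNReal.ofReal_mul ht.le, mul_comm t r, ofReal_mul_rearrOsc f hrt0]
  calc ∫⁻ s in Ioc 0 t, rearr f s
      ≤ ∫⁻ s in Ioc 0 t, (rearr f (r * t) + (rearr f s - rearr f (r * t))) :=
        lintegral_mono fun s => le_add_tsub
    _ = ENNReal.ofReal t * rearr f (r * t)
        + ∫⁻ s in Ioc 0 t, (rearr f s - rearr f (r * t)) := by
        rw [lintegral_add_left measurable_const]
        simp [mul_comm]
    _ ≤ _ := add_le_add (by gcongr; exact rearr_le_rearrAvg f hrt0)
        (lintegral_mono_set (Ioc_subset_Ioc_right hrt))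

theorem measurable_rearrAvg (f : ℝ → ℝ≥0∞) : Measurable (rearrAvg f) := by
  have h : Monotone fun t : ℝ => ∫⁻ s in Ioc 0 t, rearr f s := fun t u htu =>
    lintegral_mono_set (Ioc_subset_Ioc_right htu)
  exact ENNReal.measurable_ofReal.inv.mul h.measurable

theorem measurable_rearrOsc (f : ℝ → ℝ≥0∞) : Measurable (rearrOsc f) :=
  (measurable_rearrAvg f).sub (measurable_rearr f)

theorem rearrOsc_le_rearrAvg (f : ℝ → ℝ≥0∞) (t : ℝ) : rearrOsc f t ≤ rearrAvg f t :=
  tsub_le_self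

theorem rearrAvg_le_add_sum (f : ℝ → ℝ≥0∞) {r t : ℝ} (hr : 1 ≤ r) (ht : 0 < t) (N : ℕ) :
    rearrAvg f t ≤ rearrAvg f (r ^ N * t)
      + ∑ n ∈ Finset.range N, ENNReal.ofReal r * rearrOsc f (r ^ (n + 1) * t) := by
  induction N with
  | zero => simp
  | succ N ih =>
    have h := rearrAvg_le_add_rearrOsc f hr
      (mul_pos (pow_pos (zero_lt_one.trans_le hr) N) ht)
    rw [← mul_assoc, ← pow_succ'] at h
    rw [Finset.sum_range_succ, add_comm (∑ n ∈ _, _), ← add_assoc]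
    exact ih.trans (by gcongr)

theorem rearrAvg_le_tsum (f : ℝ → ℝ≥0∞) (hf : Tendsto (rearrAvg f) atTop (𝓝 0)) {r t : ℝ}
    (hr : 1 < r) (ht : 0 < t) :
    rearrAvg f t ≤ ∑' n : ℕ, ENNReal.ofReal r * rearrOsc f (r ^ (n + 1) * t) := by
  have h1 : Tendsto (fun N : ℕ => rearrAvg f (r ^ N * t)) atTop (𝓝 0) :=
    hf.comp ((tendsto_pow_atTop_atTop_of_one_lt hr).atTop_mul_const ht)
  have h2 := h1.add_const (∑' n : ℕ, ENNReal.ofReal r * rearrOsc f (r ^ (n + 1) * t))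
  rw [zero_add] at h2
  exact ge_of_tendsto' h2 fun N => (rearrAvg_le_add_sum f hr.le ht N).trans
    (by gcongr; exact ENNReal.sum_le_tsum _)

/-- Split at T with f*(T) ≤ ε/2: the finite mass on (0,T] is negligible after division by large t.
-/
theorem tendsto_rearrAvg_of_tendsto_rearr {f : ℝ → ℝ≥0∞}
    (hfin : ∀ t : ℝ, ∫⁻ s in Ioc 0 t, rearr f s ≠ ∞)
    (h : ∀ ε : ℝ≥0∞, 0 < ε → ∃ t : ℝ, 0 < t ∧ rearr f t ≤ ε) :
    Tendsto (rearrAvg f) atTop (𝓝 0) := by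
  rw [ENNReal.tendsto_nhds_zero]
  intro ε hε
  obtain ⟨T, hT, hle⟩ := h (ε / 2) (ENNReal.half_pos hε.ne')
  set A := ∫⁻ s in Ioc 0 T, rearr f s with hA
  have h1 : Tendsto (fun t : ℝ => (ENNReal.ofReal t)⁻¹ * A) atTop (𝓝 0) := by
    have := ENNReal.Tendsto.mul_const (b := A)
      (tendsto_inv_iff.2 ENNReal.tendsto_ofReal_atTop) (Or.inr (hfin T))
    simpa using this
  filter_upwards [ENNReal.tendsto_nhds_zero.1 h1 (ε / 2) (ENNReal.half_pos hε.ne'),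
    eventually_ge_atTop T] with t ht htT
  have ht0 : 0 < t := hT.trans_le htT
  have h2 : ∫⁻ s in Ioc 0 t, rearr f s ≤ A + ENNReal.ofReal t * (ε / 2) := by
    rw [← Ioc_union_Ioc_eq_Ioc hT.le htT]
    refine (lintegral_union_le _ _ _).trans (add_le_add le_rfl ?_)
    calc ∫⁻ s in Ioc T t, rearr f s ≤ ∫⁻ _ in Ioc T t, ε / 2 :=
          setLIntegral_mono measurable_const fun s hs => (rearr_antitone f hs.1.le).trans hle
      _ = ε / 2 * ENNReal.ofReal (t - T) := by simp
      _ ≤ _ := by rw [mul_comm]; gcongr; linarith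
  calc rearrAvg f t ≤ (ENNReal.ofReal t)⁻¹ * (A + ENNReal.ofReal t * (ε / 2)) := by
        rw [rearrAvg]; gcongr
    _ = (ENNReal.ofReal t)⁻¹ * A + ε / 2 := by
        rw [mul_add, ← mul_assoc,
          ENNReal.inv_mul_cancel (by simpa using ht0) ENNReal.ofReal_ne_top, one_mul]
    _ ≤ ε / 2 + ε / 2 := by gcongr
    _ = ε := ENNReal.add_halves ε

/-! ### Decay in X, weights, and the endpoint norms. -/

namespace RISpace

variable (X : RISpace)

theorem tendsto_rearrAvg_of_mem (hX : ∀ c : ℝ, c ≠ 0 → ¬ X.Mem (fun _ => c)) {f : ℝ → ℝ}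
    (hf : X.Mem f) : Tendsto (rearrAvg fun x => ‖f x‖ₑ) atTop (𝓝 0) := by
  have hfm : AEMeasurable (fun x => ‖f x‖ₑ) lebPos := hf.1.enorm
  have hn : X.fnorm (rearr fun x => ‖f x‖ₑ) < ∞ := by
    rw [X.fnorm_rearr hfm]; exact hf.2
  refine tendsto_rearrAvg_of_tendsto_rearr (fun t => ?_) fun ε hε => ?_
  · obtain ⟨C, hC⟩ := X.setLIntegral_le (Ioc 0 t) measurableSet_Ioc <|
      (Measure.restrict_apply_le _ _).trans_lt measure_Ioc_lt_top
    have := hC _ (measurable_rearr fun x => ‖f x‖ₑ).aemeasurable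
    rw [lebPos_restrict_Ioc] at this
    exact (this.trans_lt (ENNReal.mul_lt_top ENNReal.coe_lt_top hn)).ne
  -- Otherwise a positive constant below ε lies under f* and so belongs to X.
  · by_contra! hcon
    obtain ⟨c, hc0, hc⟩ := ENNReal.lt_iff_exists_nnreal_btwn.1 hε
    refine hX c (by exact_mod_cast hc0.ne') ⟨aemeasurable_const, lt_of_le_of_lt ?_ hn⟩
    refine X.fnorm_mono _ _ aemeasurable_const (measurable_rearr _).aemeasurable ?_
    filter_upwards [ae_lebPos_pos] with t ht
    simpa using (hc.trans (hcon t ht)).le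

/-- Homogeneity is assumed for finite scalars only; c = ∞ is needed since osc may be infinite at a
point. Approximate from below. -/
theorem mul_fnorm_le (c : ℝ≥0∞) {f : ℝ → ℝ≥0∞} (hf : AEMeasurable f lebPos) :
    c * X.fnorm f ≤ X.fnorm fun x => c * f x := by
  refine ENNReal.mul_le_of_forall_lt fun a ha b hb => ?_
  lift a to ℝ≥0 using ha.ne_top
  calc a * b ≤ a * X.fnorm f := by gcongr
    _ = X.fnorm fun x => (a : ℝ≥0∞) * f x := (X.fnorm_const_mul a f hf).symm
    _ ≤ _ := X.fnorm_mono _ _ (hf.const_mul _) (hf.const_mul _)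
      (ae_of_all _ fun x => by gcongr)

theorem fnorm_indicator_pos {E : Set ℝ} (hE : MeasurableSet E) (h : lebPos E ≠ 0) :
    X.fnorm (E.indicator fun _ => 1) ≠ 0 := by
  have hm : AEMeasurable (E.indicator fun _ => (1 : ℝ≥0∞)) lebPos :=
    (measurable_const.indicator hE).aemeasurable
  rw [Ne, X.fnorm_eq_zero_iff _ hm, indicator_ae_eq_zero]
  simpa [Function.support_const] using h

end RISpace

theorem measurable_ofReal_rpow_mul (a : ℝ) {f : ℝ → ℝ≥0∞} (hf : Measurable f) :
    AEMeasurable (fun t => ENNReal.ofReal (t ^ a) * f t) lebPos :=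
  ((ENNReal.measurable_ofReal.comp (measurable_id.pow_const a)).mul hf).aemeasurable

theorem ofReal_rpow_dilate (a : ℝ) {r t : ℝ} (hr : 0 < r) (ht : 0 < t) (n : ℕ) :
    ENNReal.ofReal (t ^ (-a))
      = ENNReal.ofReal (r ^ a) ^ n * ENNReal.ofReal ((r ^ n * t) ^ (-a)) := by
  rw [← ENNReal.ofReal_pow (by positivity), ← ENNReal.ofReal_mul (by positivity),
    Real.mul_rpow (by positivity) ht.le, ← Real.rpow_natCast_mul hr.le,
    ← Real.rpow_mul_natCast hr.le, ← mul_assoc, ← Real.rpow_add hr]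
  congr 1
  ring_nf
  simp

/-- If f = g + h then f* ≤ g* + ‖h‖_∞; integrate over (0,1]. -/
theorem rearrAvg_one_le_sumNorm (f : ℝ → ℝ) :
    rearrAvg (fun x => ‖f x‖ₑ) 1 ≤ sumNorm f := by
  refine le_iInf fun g => le_iInf fun h => le_iInf fun hg => le_iInf fun hh => le_iInf fun hgh => ?_
  have key : ∀ t, rearr (fun x => ‖f x‖ₑ) t
      ≤ rearr (fun x => ‖g x‖ₑ) t + eLpNorm h ∞ lebPos := by
    intro t
    rw [rearr_le_iff]
    refine le_trans (measure_mono_ae ?_) ((rearr_le_iff (fun x => ‖g x‖ₑ) t _).1 le_rfl)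
    rw [eLpNorm_exponent_top]
    filter_upwards [hgh, enorm_ae_le_eLpNormEssSup h lebPos] with x hx hx'
    intro hlt
    refine lt_of_not_ge fun hle => (not_le_of_gt hlt) ?_
    show ‖f x‖ₑ ≤ _
    rw [hx]
    exact (enorm_add_le _ _).trans (add_le_add hle hx')
  have h1 : rearrAvg (fun x => ‖f x‖ₑ) 1 = ∫⁻ s in Ioc 0 1, rearr (fun x => ‖f x‖ₑ) s := by
    simp [rearrAvg]
  rw [h1]
  calc _ ≤ ∫⁻ s in Ioc (0 : ℝ) 1, (rearr (fun x => ‖g x‖ₑ) s + eLpNorm h ∞ lebPos) :=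
        lintegral_mono fun s => key s
    _ = (∫⁻ s in Ioc (0 : ℝ) 1, rearr (fun x => ‖g x‖ₑ) s) + eLpNorm h ∞ lebPos := by
        rw [lintegral_add_right _ measurable_const]; simp
    _ ≤ _ := by
        gcongr
        rw [eLpNorm_one_eq_lintegral_enorm, ← lintegral_rearr hg.aemeasurable.enorm]
        exact lintegral_mono_set fun x hx => hx.1

theorem eLpNorm_top_le_of_rearr_le {f : ℝ → ℝ} {K : ℝ≥0∞} {u : ℕ → ℝ}
    (hu : Tendsto u atTop (𝓝 0)) (h : ∀ n, rearr (fun x => ‖f x‖ₑ) (u n) ≤ K) :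
    eLpNorm f ∞ lebPos ≤ K := by
  rw [eLpNorm_exponent_top]
  refine essSup_le_of_ae_le K ?_
  have h0 : lebPos {x | K < ‖f x‖ₑ} ≤ 0 := by
    have := ENNReal.tendsto_ofReal hu
    rw [ENNReal.ofReal_zero] at this
    exact ge_of_tendsto' this fun n => (rearr_le_iff _ _ _).1 (h n)
  have h1 : ∀ᵐ x ∂lebPos, ¬ K < ‖f x‖ₑ := by
    rw [ae_iff]; simpa using h0
  filter_upwards [h1] with x hx using not_lt.1 hx

/-! ### The two geometric-series estimates. -/

namespace RISpace

variable (X : RISpace)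

theorem exists_fnorm_rearrAvg_le {a : ℝ} (ha : (a : EReal) < X.lowerBoyd) :
    ∃ C : ℝ≥0, ∀ f : ℝ → ℝ≥0∞, Tendsto (rearrAvg f) atTop (𝓝 0) →
      X.fnorm (fun t => ENNReal.ofReal (t ^ (-a)) * rearrAvg f t) ≤
        C * X.fnorm (fun t => ENNReal.ofReal (t ^ (-a)) * rearrOsc f t) := by
  obtain ⟨s, ⟨hs0, hs1⟩, hs⟩ := X.exists_dilationNorm_lt_of_lt_lowerBoyd ha
  obtain ⟨κ, hκ, hκs⟩ := exists_between hs
  obtain ⟨r, rfl⟩ : ∃ r : ℝ, s = r⁻¹ := ⟨s⁻¹, (inv_inv s).symm⟩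
  have hr0 : 0 < r := inv_pos.1 hs0
  have hr1 : 1 < r := (inv_lt_one₀ hr0).1 hs1
  set ρ : ℝ≥0 := (r ^ a).toNNReal with hρ
  have hρr : ENNReal.ofReal (r ^ a) = ρ := rfl
  set q : ℝ≥0∞ := ρ * κ with hq
  -- The weight costs r^a per dilation, while κ < r^(-a).
  have hq1 : q < 1 := by
    have h0 : (ρ : ℝ≥0∞) ≠ 0 := by
      rw [← hρr]; simpa using Real.rpow_pos_of_pos hr0 a
    rw [Real.inv_rpow hr0.le, ENNReal.ofReal_inv_of_pos (Real.rpow_pos_of_pos hr0 a), hρr] at hκs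
    calc q < ρ * (ρ : ℝ≥0∞)⁻¹ := ENNReal.mul_lt_mul_right h0 ENNReal.coe_ne_top hκs
      _ = 1 := ENNReal.mul_inv_cancel h0 ENNReal.coe_ne_top
  have hsum : ∑' n : ℕ, (r.toNNReal : ℝ≥0∞) * q ^ (n + 1) ≠ ∞ := by
    rw [ENNReal.tsum_mul_left, ENNReal.tsum_geometric_add_one]
    refine ENNReal.mul_ne_top ENNReal.coe_ne_top (ENNReal.mul_ne_top hq1.ne_top ?_)
    exact ENNReal.inv_ne_top.2 (tsub_pos_of_lt hq1).ne'
  refine ⟨(∑' n : ℕ, (r.toNNReal : ℝ≥0∞) * q ^ (n + 1)).toNNReal, fun f hf => ?_⟩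
  rw [ENNReal.coe_toNNReal hsum]
  set G : ℝ → ℝ≥0∞ := fun t => ENNReal.ofReal (t ^ (-a)) * rearrOsc f t with hG
  have hGm : AEMeasurable G lebPos := measurable_ofReal_rpow_mul _ (measurable_rearrOsc f)
  have hGn : ∀ n : ℕ, AEMeasurable (fun t => G (r ^ n * t)) lebPos := fun n =>
    aemeasurable_comp_mul_left (pow_pos hr0 n) hGm
  have hterm : ∀ n : ℕ, AEMeasurable
      (fun t => ((r.toNNReal * ρ ^ (n + 1) : ℝ≥0) : ℝ≥0∞) * G (r ^ (n + 1) * t)) lebPos :=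
    fun n => (hGn (n + 1)).const_mul _
  calc X.fnorm (fun t => ENNReal.ofReal (t ^ (-a)) * rearrAvg f t)
      ≤ X.fnorm (fun t => ∑' n : ℕ,
          ((r.toNNReal * ρ ^ (n + 1) : ℝ≥0) : ℝ≥0∞) * G (r ^ (n + 1) * t)) := by
        refine X.fnorm_mono _ _ (measurable_ofReal_rpow_mul _ (measurable_rearrAvg f))
          (AEMeasurable.tsum hterm) ?_
        filter_upwards [ae_lebPos_pos] with t ht
        refine (mul_le_mul_right (rearrAvg_le_tsum f hf hr1 ht) _).trans ?_
        rw [← ENNReal.tsum_mul_left]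
        refine ENNReal.tsum_le_tsum fun n => le_of_eq ?_
        rw [ofReal_rpow_dilate a hr0 ht (n + 1), hρr]
        simp only [hG, ENNReal.ofReal]
        push_cast
        ring
    _ ≤ ∑' n : ℕ, X.fnorm (fun t =>
          ((r.toNNReal * ρ ^ (n + 1) : ℝ≥0) : ℝ≥0∞) * G (r ^ (n + 1) * t)) :=
        X.fnorm_tsum_le hterm
    _ ≤ ∑' n : ℕ, (r.toNNReal : ℝ≥0∞) * q ^ (n + 1) * X.fnorm G := by
        refine ENNReal.tsum_le_tsum fun n => ?_
        rw [X.fnorm_const_mul _ _ (hGn (n + 1))]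
        refine (mul_le_mul_right (X.fnorm_comp_pow_mul_left_le hr0 hκ hGm (n + 1)) _).trans ?_
        refine le_of_eq ?_
        rw [hq]
        push_cast
        ring
    _ = _ := ENNReal.tsum_mul_right

/-- Monotonicity of t·osc(t) turns the point value osc(r^(-n)) into a lower bound for osc on
(r^(-n), r^(1-n)], hence into a norm bound. -/
theorem exists_tsum_rearrOsc_le {a : ℝ} (ha0 : 0 ≤ a) (ha : X.upperBoyd < (a : EReal)) :
    ∃ r : ℝ, 1 < r ∧ ∃ C : ℝ≥0, ∀ f : ℝ → ℝ≥0∞,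
      ∑' n : ℕ, ENNReal.ofReal r * rearrOsc f (r⁻¹ ^ n) ≤
        C * X.fnorm (fun t => ENNReal.ofReal (t ^ (-a)) * rearrOsc f t) := by
  obtain ⟨r, hr1, hr⟩ := X.exists_dilationNorm_lt_of_upperBoyd_lt ha
  obtain ⟨κ, hκ, hκr⟩ := exists_between hr
  have hr0 : 0 < r := zero_lt_one.trans hr1
  have hi0 : 0 < r⁻¹ := inv_pos.2 hr0
  rw [← inv_inv r] at hκ
  set σ : ℝ≥0 := (r⁻¹ ^ a).toNNReal with hσ
  have hσr : ENNReal.ofReal (r⁻¹ ^ a) = σ := rfl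
  -- Chosen so that t ≤ R·t^(-a) on (1,r]; this uses a ≥ 0.
  set R : ℝ≥0 := (r * r ^ a).toNNReal with hR
  set q : ℝ≥0∞ := σ * κ with hq
  have hq1 : q < 1 := by
    have hp : 0 < r⁻¹ ^ a := Real.rpow_pos_of_pos hi0 a
    have h0 : (σ : ℝ≥0∞) ≠ 0 := by rw [← hσr]; simpa using hp
    calc q < σ * ENNReal.ofReal (r ^ a) := ENNReal.mul_lt_mul_right h0 ENNReal.coe_ne_top hκr
      _ = 1 := by
        rw [← hσr, ← ENNReal.ofReal_mul hp.le, ← Real.mul_rpow hi0.le hr0.le,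
          inv_mul_cancel₀ hr0.ne']
        simp
  set χ : ℝ → ℝ≥0∞ := (Ioc 1 r).indicator fun _ => 1 with hχ
  have hχm : AEMeasurable χ lebPos :=
    (measurable_const.indicator measurableSet_Ioc).aemeasurable
  have hIoc : lebPos (Ioc 1 r) = ENNReal.ofReal (r - 1) := by
    rw [lebPos, Measure.restrict_apply measurableSet_Ioc,
      inter_eq_left.2 fun x hx => mem_Ioi.2 (zero_lt_one.trans hx.1), Real.volume_Ioc]
  have hχ0 : X.fnorm χ ≠ 0 :=
    X.fnorm_indicator_pos measurableSet_Ioc (by rw [hIoc]; simpa using hr1)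
  have hχt : X.fnorm χ ≠ ∞ :=
    (X.fnorm_indicator_lt_top _ measurableSet_Ioc (by rw [hIoc]; simp)).ne
  have hsum : ∑' n : ℕ, ENNReal.ofReal r * (R * q ^ n * (X.fnorm χ)⁻¹) ≠ ∞ := by
    rw [ENNReal.tsum_mul_left, ENNReal.tsum_mul_right, ENNReal.tsum_mul_left,
      ENNReal.tsum_geometric]
    exact ENNReal.mul_ne_top ENNReal.ofReal_ne_top (ENNReal.mul_ne_top
      (ENNReal.mul_ne_top ENNReal.coe_ne_top (ENNReal.inv_ne_top.2 (tsub_pos_of_lt hq1).ne'))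
      (ENNReal.inv_ne_top.2 hχ0))
  refine ⟨r, hr1, (∑' n : ℕ, ENNReal.ofReal r * (R * q ^ n * (X.fnorm χ)⁻¹)).toNNReal,
    fun f => ?_⟩
  rw [ENNReal.coe_toNNReal hsum]
  set G : ℝ → ℝ≥0∞ := fun t => ENNReal.ofReal (t ^ (-a)) * rearrOsc f t with hG
  have hGm : AEMeasurable G lebPos := measurable_ofReal_rpow_mul _ (measurable_rearrOsc f)
  rw [← ENNReal.tsum_mul_right]
  refine ENNReal.tsum_le_tsum fun n => ?_
  rw [mul_assoc]
  gcongr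
  have hGn : AEMeasurable (fun t => G (r⁻¹ ^ n * t)) lebPos :=
    aemeasurable_comp_mul_left (pow_pos hi0 n) hGm
  have hmain : rearrOsc f (r⁻¹ ^ n) * X.fnorm χ ≤ R * q ^ n * X.fnorm G := by
    calc _ ≤ X.fnorm fun t => rearrOsc f (r⁻¹ ^ n) * χ t := X.mul_fnorm_le _ hχm
      _ ≤ X.fnorm fun t => ((R * σ ^ n : ℝ≥0) : ℝ≥0∞) * G (r⁻¹ ^ n * t) := by
        refine X.fnorm_mono _ _ (hχm.const_mul _) (hGn.const_mul _) (ae_of_all _ fun t => ?_)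
        by_cases ht : t ∈ Ioc 1 r
        swap
        · simp [hχ, ht]
        have ht0 : 0 < t := zero_lt_one.trans ht.1
        set y := r⁻¹ ^ n with hy
        have hy0 : 0 < y := pow_pos hi0 n
        have hosc : rearrOsc f y ≤ ENNReal.ofReal t * rearrOsc f (y * t) := by
          have h := ofReal_mul_rearrOsc_mono f hy0 (le_mul_of_one_le_right hy0.le ht.1.le)
          rwa [ENNReal.ofReal_mul hy0.le, mul_assoc, ENNReal.mul_le_mul_iff_right
            (by simpa using hy0) ENNReal.ofReal_ne_top] at h
        have hw : ENNReal.ofReal t ≤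
            ((R * σ ^ n : ℝ≥0) : ℝ≥0∞) * ENNReal.ofReal ((y * t) ^ (-a)) := by
          have h := ofReal_rpow_dilate a hi0 ht0 n
          rw [hσr] at h
          push_cast
          rw [mul_assoc, ← h]
          show _ ≤ ENNReal.ofReal (r * r ^ a) * _
          rw [← ENNReal.ofReal_mul (by positivity)]
          refine ENNReal.ofReal_le_ofReal ?_
          have h1 : 1 ≤ r ^ a * t ^ (-a) := by
            rw [Real.rpow_neg ht0.le, ← div_eq_mul_inv,
              one_le_div (Real.rpow_pos_of_pos ht0 a)]
            exact Real.rpow_le_rpow ht0.le ht.2 ha0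
          calc t ≤ r * 1 := by simpa using ht.2
            _ ≤ r * (r ^ a * t ^ (-a)) := by gcongr
            _ = _ := by ring
        simp only [hχ, indicator_of_mem ht, mul_one, hG]
        rw [← mul_assoc]
        exact hosc.trans (by gcongr)
      _ ≤ _ := by
        rw [X.fnorm_const_mul _ _ hGn]
        refine (mul_le_mul_right (X.fnorm_comp_pow_mul_left_le hi0 hκ hGm n) _).trans ?_
        refine le_of_eq ?_
        rw [hq]
        push_cast
        ring
  rw [← ENNReal.le_div_iff_mul_le (Or.inl hχ0) (Or.inl hχt)] at hmain
  refine hmain.trans (le_of_eq ?_)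
  rw [div_eq_mul_inv]
  ring

end RISpace

theorem rearr_inv_pow_le (f : ℝ → ℝ≥0∞) {r : ℝ} (hr : 1 < r) (N : ℕ) :
    rearr f (r⁻¹ ^ N) ≤
      rearrAvg f 1 + ∑' n : ℕ, ENNReal.ofReal r * rearrOsc f (r⁻¹ ^ n) := by
  have hr0 : 0 < r := zero_lt_one.trans hr
  have hp : 0 < r⁻¹ ^ N := pow_pos (inv_pos.2 hr0) N
  have h := rearrAvg_le_add_sum f hr.le hp N
  rw [← mul_pow, mul_inv_cancel₀ hr0.ne', one_pow, ← Finset.sum_range_reflect] at h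
  refine (rearr_le_rearrAvg f hp).trans (h.trans ?_)
  gcongr
  refine le_trans (le_of_eq (Finset.sum_congr rfl fun n hn => ?_)) (ENNReal.sum_le_tsum
    (Finset.range N))
  -- After reflection the n-th dilation exponent is N - n, so the evaluation point is r^(-n).
  have hnN : N = n + (N - 1 - n + 1) := by have := Finset.mem_range.1 hn; omega
  congr 2
  conv_lhs => rw [show r⁻¹ ^ N = r⁻¹ ^ (N - 1 - n + 1) * r⁻¹ ^ n by
    rw [← pow_add, add_comm, ← hnN]]
  rw [← mul_assoc, ← mul_pow, mul_inv_cancel₀ hr0.ne', one_pow, one_mul]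

theorem theorem2p3 (X : RISpace) (hX : ∀ c : ℝ, c ≠ 0 → ¬ X.Mem (fun _ => c))
    (D : ℝ) (hD : 0 < D) :
    (((1 / D : ℝ) : EReal) < X.lowerBoyd →
      ∃ C : ℝ≥0, 0 < C ∧ ∀ f : ℝ → ℝ, AEMeasurable f lebPos →
        (X.Mem f ∨ Tendsto (rearrAvg fun x => ‖f x‖ₑ) atTop (𝓝 0)) →
        X.fnorm (fun t => ENNReal.ofReal (t ^ (-(1 / D))) * rearrAvg (fun x => ‖f x‖ₑ) t) ≤
            C * X.fnorm
              (fun t => ENNReal.ofReal (t ^ (-(1 / D))) * rearrOsc (fun x => ‖f x‖ₑ) t) ∧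
          X.fnorm
              (fun t => ENNReal.ofReal (t ^ (-(1 / D))) * rearrOsc (fun x => ‖f x‖ₑ) t) ≤
            C * X.fnorm
              (fun t => ENNReal.ofReal (t ^ (-(1 / D))) * rearrAvg (fun x => ‖f x‖ₑ) t)) ∧
    (X.upperBoyd < ((1 / D : ℝ) : EReal) →
      ∃ C : ℝ≥0, 0 < C ∧ ∀ f : ℝ → ℝ, AEMeasurable f lebPos →
        eLpNorm f ∞ lebPos ≤
          C * (X.fnorm
              (fun t => ENNReal.ofReal (t ^ (-(1 / D))) * rearrOsc (fun x => ‖f x‖ₑ) t) +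
            sumNorm f)) := by
  refine ⟨fun h => ?_, fun h => ?_⟩
  · obtain ⟨C, hC⟩ := X.exists_fnorm_rearrAvg_le h
    refine ⟨max 1 C, by positivity, fun f hf hcase => ⟨?_, ?_⟩⟩
    · refine (hC _ (hcase.elim (X.tendsto_rearrAvg_of_mem hX) id)).trans ?_
      gcongr
      exact le_max_right _ _
    · refine le_trans (X.fnorm_mono _ _
        (measurable_ofReal_rpow_mul _ (measurable_rearrOsc _))
        (measurable_ofReal_rpow_mul _ (measurable_rearrAvg _))
        (ae_of_all _ fun t => mul_le_mul_right (rearrOsc_le_rearrAvg _ t) _)) ?_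
      refine le_mul_of_one_le_left zero_le ?_
      exact_mod_cast le_max_left 1 C
  · obtain ⟨r, hr, C, hC⟩ := X.exists_tsum_rearrOsc_le (by positivity) h
    -- The 1 covers the coefficient of the L¹ + L^∞ norm and ensures positivity.
    refine ⟨max 1 C, by positivity, fun f _ => ?_⟩
    have hu : Tendsto (fun n : ℕ => r⁻¹ ^ n) atTop (𝓝 0) :=
      tendsto_pow_atTop_nhds_zero_of_lt_one (by positivity) (inv_lt_one_of_one_lt₀ hr)
    refine (eLpNorm_top_le_of_rearr_le hu (rearr_inv_pow_le _ hr)).trans ?_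
    rw [mul_add, add_comm]
    refine add_le_add ((hC _).trans ?_) ((rearrAvg_one_le_sumNorm f).trans ?_)
    · gcongr
      exact le_max_right _ _
    · refine le_mul_of_one_le_left zero_le ?_
      exact_mod_cast le_max_left 1 C
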